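/- Let $\mathbb{K}$ be an algebraically closed field of characteristic $p\ge 0$ with a nontrivial real-valued (rank one) valuation $v$, let $\Gamma=v(\mathbb{K}^*)\subseteq\mathbb{R}$ be its value group, and put $T(x)=-v(x)$ for $x\in\mathbb{K}^*$. For a tropical polynomial $F(w)=\max_{m\in S}\{c_m+m\cdot w\}$ with finite support $S\subset\mathbb{N}^n$ and coefficients $c_m\in\Gamma$, let $\mathcal{T}(F)$ be the set of $w\in\Gamma^n$ at which the maximum is attained for at least two different $m\in S$; its elements are the tropical roots of $F$. Let $I,J\subset\mathbb{N}$ be finite sets with at least two elements each and with $0\in I\cap J$. A polynomial $R\in(\mathbb{Z}/p\mathbb{Z})[a_i,b_j : i\in I,\ j\in J]$ is called a resultant of supports $I,J$ over $\mathbb{K}$ if, for all values $a_i,b_j\in\mathbb{K}$ with $a_0\,a_{\max I}\,b_0\,b_{\max J}\neq0$, it vanishes at $(a_i,b_j)$ if and only if $\sum_{i\in I}a_ix^i$ and $\sum_{j\in J}b_jx^j$ have a common root in $\mathbb{K}$. Then: (1) The Sylvester resultant, for the degrees $\max I$ and $\max J$, of the polynomials $\sum_{i\in I}a_ix^i$ and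 $\sum_{j\in J}b_jx^j$ with indeterminate coefficients is a resultant of supports $I,J$ over $\mathbb{K}$. (2) Let $R(I,J,\mathbb{K})$ be this Sylvester resultant, or any other resultant of supports $I,J$ over $\mathbb{K}$. Let $R_t(I,J,\mathbb{K})$ be its tropicalization, obtained by replacing every coefficient that is nonzero in $\mathbb{K}$ by its image under $T$. Then for all $(a_i)_{i\in I}\in\Gamma^I$ and $(b_j)_{j\in J}\in\Gamma^J$, the univariate tropical polynomials $f(x)=\max_{i\in I}\{a_i+ix\}$ and $g(x)=\max_{j\in J}\{b_j+jx\}$ have a common tropical root in $\Gamma$ if and only if the point $(a_i,b_j)$ belongs to $\mathcal{T}(R_t(I,J,\mathbb{K}))$. -/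

import Mathlib

/-- The value group `Γ ⊆ ℝ` of a real-valued valuation on a field, as an additive
subgroup of `ℝ`; its elements are the values of the nonzero elements of `K`. -/
def valueGroup {K : Type*} [Field K] (v : AddValuation K (WithTop ℝ)) : AddSubgroup ℝ where
  carrier := {γ | ∃ x : K, v x = (γ : WithTop ℝ)}
  zero_mem' := ⟨1, by simp⟩
  add_mem' := by
    rintro a b ⟨x, hx⟩ ⟨y, hy⟩
    exact ⟨x * y, by rw [v.map_mul, hx, hy, WithTop.coe_add]⟩
  neg_mem' := by
    rintro a ⟨x, hx⟩
    refine ⟨x⁻¹, ?_⟩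
    have hx0 : x ≠ 0 := by
      rintro rfl
      simp at hx
    have h : v x + v x⁻¹ = 0 := by
      rw [← v.map_mul, mul_inv_cancel₀ hx0, v.map_one]
    rw [hx] at h
    cases hy : v x⁻¹ with
    | top => rw [hy] at h; simp at h
    | coe c =>
      rw [hy] at h
      have h' : a + c = 0 := by exact_mod_cast h
      rw [show c = -a by linarith]

/-- The tropicalization map `T(x) = -v(x)` on nonzero elements, with values in `Γ`. -/
noncomputable def tropVal {K : Type*} [Field K] (v : AddValuation K (WithTop ℝ))
    (x : K) (hx : x ≠ 0) : valueGroup v :=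
  -⟨(v x).untop ((v.ne_top_iff).2 hx), x, (WithTop.coe_untop _ _).symm⟩

/-- The maximum of the family `φ` is attained for at least two different indices. -/
def MaxAttainedTwice {ι Γ : Type*} [LE Γ] (φ : ι → Γ) : Prop :=
  ∃ i j : ι, i ≠ j ∧ ∀ k : ι, φ k ≤ φ i ∧ φ k ≤ φ j

/-- `x` is a root of the univariate tropical polynomial `max_{i ∈ I} (a_i + i x)` of
support `I`. -/
def IsTropicalRoot {Γ : Type*} [AddCommGroup Γ] [LE Γ] {I : Finset ℕ} (a : I → Γ) (x : Γ) :
    Prop :=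
  MaxAttainedTwice fun i : I => a i + (i : ℕ) • x

/-- A tropical polynomial with variables indexed by `σ` and coefficients in `Γ`. -/
structure TropicalPolynomial (σ Γ : Type*) where
  support : Finset (σ →₀ ℕ)
  coeff : support → Γ

/-- The tropical hypersurface defined by `F`: the points of `Γ^σ` at which
`max_m (F_m + ∑ s, m_s w_s)` is attained for at least two exponents `m` of the support. -/
def TropicalPolynomial.zeros {σ Γ : Type*} [AddCommGroup Γ] [LE Γ]
    (F : TropicalPolynomial σ Γ) : Set (σ → Γ) :=
  {w | MaxAttainedTwice fun m : F.support => F.coeff m + (m : σ →₀ ℕ).sum fun s e => e • w s}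

/-- Coefficientwise tropicalization of a polynomial over a valued field. -/
noncomputable def tropicalization {K σ : Type*} [Field K] (v : AddValuation K (WithTop ℝ))
    (F : MvPolynomial σ K) : TropicalPolynomial σ (valueGroup v) where
  support := F.support
  coeff m := tropVal v (F.coeff m) (MvPolynomial.mem_support_iff.1 m.2)

/-- The Sylvester resultant of the two polynomials `∑_{i ∈ I} a_i x^i` and
`∑_{j ∈ J} b_j x^j` with indeterminate coefficients, of degrees `max I` and `max J`, as a
polynomial over `ℤ/pℤ` (over `ℤ` if `p = 0`) in the variables `a_i` and `b_j`. -/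
noncomputable def sylvesterResultant (p : ℕ) (I J : Finset ℕ) : MvPolynomial (I ⊕ J) (ZMod p) :=
  Polynomial.resultant
    (∑ i : I, Polynomial.C (MvPolynomial.X (Sum.inl i)) * Polynomial.X ^ (i : ℕ))
    (∑ j : J, Polynomial.C (MvPolynomial.X (Sum.inr j)) * Polynomial.X ^ (j : ℕ))
    (I.sup id) (J.sup id)

/-- `R` is a resultant of supports `I`, `J` over `K`: for all coefficients in `K` with nonzero
constant and leading coefficients (i.e. `a_0 a_n b_0 b_m ≠ 0` with `n = max I`, `m = max J`),
`R` vanishes at the coefficients if and only if the two polynomials have a common root. -/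
def IsResultant (p : ℕ) (K : Type*) [Field K] [CharP K p] (I J : Finset ℕ)
    (R : MvPolynomial (I ⊕ J) (ZMod p)) : Prop :=
  ∀ (a : I → K) (b : J → K),
    (∀ i : I, (i : ℕ) = 0 ∨ (i : ℕ) = I.sup id → a i ≠ 0) →
    (∀ j : J, (j : ℕ) = 0 ∨ (j : ℕ) = J.sup id → b j ≠ 0) →
    (MvPolynomial.eval₂ (ZMod.castHom dvd_rfl K) (Sum.elim a b) R = 0 ↔
      ∃ x : K, ∑ i : I, a i * x ^ (i : ℕ) = 0 ∧ ∑ j : J, b j * x ^ (j : ℕ) = 0)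

/-- The tropicalization `R_t` of a polynomial `R` over the prime ring `ℤ/pℤ` of `K`, whose
coefficients are regarded as elements of `K`. -/
noncomputable def tropicalResultant {p : ℕ} {K : Type*} [Field K] [CharP K p]
    (v : AddValuation K (WithTop ℝ)) {I J : Finset ℕ} (R : MvPolynomial (I ⊕ J) (ZMod p)) :
    TropicalPolynomial (I ⊕ J) (valueGroup v) :=
  tropicalization v (MvPolynomial.map (ZMod.castHom dvd_rfl K) R)

/-! The proof passes between tropical and algebraic common roots by lifting. Given a common tropical
root `q`, fix `x` with `T(x) = q`. Since each maximum is attained twice, the two coefficient vectors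
lift so that both polynomials vanish at `x`. Then `R` vanishes at the lift, and in a vanishing sum
of monomials the least valuation occurs twice, so the tropicalization of `R` vanishes too.
Conversely, Kapranov's theorem for one polynomial (`exists_lift_of_mem_zeros_tropicalization`) lifts
a zero of `R_t` to a zero of `R`. The lifted polynomials share a root, which is nonzero because the
constant terms are, and its image under `T` is a common tropical root. Kapranov's theorem is reduced
to one variable by restricting to a monomial curve, where `HasUniqueMinCoeff.mul` decides whether a
root of valuation zero exists. -/

open Polynomial in
/-- Two polynomials over an algebraically closed field, one of them nonzero, have vanishing
resultant if and only if they have a common root. -/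
theorem resultant_eq_zero_iff_exists_common_root {K : Type*} [Field K] [IsAlgClosed K]
    {f g : K[X]} (hf : f ≠ 0) :
    resultant f g = 0 ↔ ∃ x : K, f.eval x = 0 ∧ g.eval x = 0 := by
  rw [resultant_eq_zero_iff, isCoprime_iff_aeval_ne_zero_of_isAlgClosed K K]
  simp [hf, coe_aeval_eq_eval]

/-! ### Univariate polynomials of prescribed support -/

section Sparse

open Polynomial

variable {K : Type*} [Field K] {I : Finset ℕ}

/-- The polynomial `∑_{i ∈ I} a_i x^i`. -/
noncomputable def sparsePolynomial (a : I → K) : K[X] := ∑ i : I, C (a i) * X ^ (i : ℕ)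

theorem eval_sparsePolynomial (a : I → K) (x : K) :
    (sparsePolynomial a).eval x = ∑ i : I, a i * x ^ (i : ℕ) := by
  simp [sparsePolynomial, eval_finsetSum]

theorem coeff_sparsePolynomial (a : I → K) (i : I) : (sparsePolynomial a).coeff i = a i := by
  rw [sparsePolynomial, finsetSum_coeff, Finset.sum_eq_single i]
  · simp
  · intro j _ hj
    rw [coeff_C_mul_X_pow, if_neg]
    exact fun h => hj (Subtype.ext h.symm)
  · simp

theorem sup_id_mem (hI : I.Nonempty) : I.sup id ∈ I := by
  obtain ⟨i, hi, h⟩ := Finset.exists_mem_eq_sup I hI id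
  rw [h]
  exact hi

theorem natDegree_sparsePolynomial (hI : I.Nonempty) (a : I → K)
    (ha : a ⟨I.sup id, sup_id_mem hI⟩ ≠ 0) : (sparsePolynomial a).natDegree = I.sup id := by
  apply le_antisymm
  · refine natDegree_sum_le_of_forall_le _ _ fun i _ => ?_
    exact (natDegree_C_mul_X_pow_le _ _).trans (Finset.le_sup (f := id) i.2)
  · apply le_natDegree_of_ne_zero
    rw [coeff_sparsePolynomial a ⟨I.sup id, sup_id_mem hI⟩]
    exact ha

theorem sup_id_ne_zero (hI : 2 ≤ I.card) : I.sup id ≠ 0 := by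
  obtain ⟨i, hi, j, hj, hij⟩ := Finset.one_lt_card.1 hI
  have h1 : i ≤ I.sup id := Finset.le_sup (f := id) hi
  have h2 : j ≤ I.sup id := Finset.le_sup (f := id) hj
  omega

/-- A binomial `x^(max I) - c` with prescribed nonzero `c` has support in `I`. -/
theorem exists_binomial_of_support (hI : 2 ≤ I.card) (hI0 : 0 ∈ I) {c : K} (hc : c ≠ 0) :
    ∃ a : I → K, (∀ i : I, (i : ℕ) = 0 ∨ (i : ℕ) = I.sup id → a i ≠ 0) ∧
      ∀ x : K, ∑ i : I, a i * x ^ (i : ℕ) = x ^ I.sup id - c := by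
  have h0 := sup_id_ne_zero hI
  have hm := sup_id_mem ⟨0, hI0⟩
  refine ⟨fun i => (if (i : ℕ) = I.sup id then 1 else 0) - if (i : ℕ) = 0 then c else 0, ?_, ?_⟩
  · rintro ⟨i, hi⟩ (h | h)
    · simp only at h
      subst h
      simp [h0.symm, hc]
    · simp only at h
      simp [h, h0]
  · intro x
    rw [Finset.sum_coe_sort I fun i =>
      ((if i = I.sup id then 1 else 0) - if i = 0 then c else 0) * x ^ i]
    simp only [sub_mul, Finset.sum_sub_distrib, ite_mul, one_mul, zero_mul]
    rw [Finset.sum_ite_eq' I, Finset.sum_ite_eq' I, if_pos hm, if_pos hI0]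
    simp

end Sparse

/-! ### Specialization of the Sylvester resultant -/

theorem eval₂_sylvesterResultant {p : ℕ} {K : Type*} [Field K] [CharP K p] {I J : Finset ℕ}
    (a : I → K) (b : J → K) :
    MvPolynomial.eval₂ (ZMod.castHom dvd_rfl K) (Sum.elim a b) (sylvesterResultant p I J) =
      Polynomial.resultant (sparsePolynomial a) (sparsePolynomial b) (I.sup id) (J.sup id) := by
  rw [← MvPolynomial.coe_eval₂Hom, sylvesterResultant, ← Polynomial.resultant_map_map]
  congr 1 <;> simp [sparsePolynomial, Polynomial.map_sum]

/-- Nonzero leading coefficients make the formal degrees `max I` and `max J` the actual ones, so the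
common-root criterion applies after specialization. -/
theorem isResultant_sylvesterResultant (p : ℕ) (K : Type*) [Field K] [IsAlgClosed K] [CharP K p]
    {I J : Finset ℕ} (hI : I.Nonempty) (hJ : J.Nonempty) :
    IsResultant p K I J (sylvesterResultant p I J) := by
  intro a b ha hb
  have ha' := ha ⟨_, sup_id_mem hI⟩ (Or.inr rfl)
  have hb' := hb ⟨_, sup_id_mem hJ⟩ (Or.inr rfl)
  have hf : sparsePolynomial a ≠ 0 := by
    intro h
    apply ha'
    rw [← coeff_sparsePolynomial a, h, Polynomial.coeff_zero]
  rw [eval₂_sylvesterResultant, ← natDegree_sparsePolynomial hI a ha',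
    ← natDegree_sparsePolynomial hJ b hb', resultant_eq_zero_iff_exists_common_root hf]
  simp only [eval_sparsePolynomial]

/-! ### Valuations of sums and lifting of tropical roots -/

section Valued

variable {K : Type*} [Field K] {v : AddValuation K (WithTop ℝ)}

theorem valuation_eq_neg_tropVal (x : K) (hx : x ≠ 0) :
    v x = ((-(tropVal v x hx : ℝ) : ℝ) : WithTop ℝ) := by
  simp [tropVal]

theorem exists_valuation_eq_neg (γ : valueGroup v) :
    ∃ x : K, v x = ((-(γ : ℝ) : ℝ) : WithTop ℝ) :=
  (-γ).2

theorem ne_zero_of_valuation_eq_coe {x : K} {r : ℝ} (h : v x = (r : WithTop ℝ)) : x ≠ 0 :=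
  v.ne_top_iff.1 (h ▸ WithTop.coe_ne_top)

theorem valuation_eq_zero_of_pow {x : K} {n : ℕ} (hn : n ≠ 0) (h : v (x ^ n) = 0) : v x = 0 := by
  rw [v.map_pow] at h
  cases hx : v x with
  | top =>
    rw [hx] at h
    obtain ⟨k, rfl⟩ := Nat.exists_eq_succ_of_ne_zero hn
    rw [succ_nsmul] at h
    simp at h
  | coe r =>
    rw [hx, ← WithTop.coe_nsmul, WithTop.coe_eq_zero] at h
    rw [WithTop.coe_eq_zero]
    simpa [hn] using h

theorem valuation_mul_pow {x y : K} {r s : ℝ} (hx : v x = ((-r : ℝ) : WithTop ℝ))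
    (hy : v y = ((-s : ℝ) : WithTop ℝ)) (n : ℕ) :
    v (x * y ^ n) = ((-(r + n • s) : ℝ) : WithTop ℝ) := by
  rw [v.map_mul, v.map_pow, hx, hy, ← WithTop.coe_nsmul, ← WithTop.coe_add]
  congr 1
  simp only [nsmul_eq_mul]
  ring

theorem maxAttainedTwice_iff {ι : Type*} {φ : ι → valueGroup v} {y : ι → K}
    (hy : ∀ i, v (y i) = ((-(φ i : ℝ) : ℝ) : WithTop ℝ)) :
    MaxAttainedTwice φ ↔
      ∃ i j : ι, i ≠ j ∧ ∀ k : ι, v (y i) ≤ v (y k) ∧ v (y j) ≤ v (y k) := by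
  simp only [MaxAttainedTwice, hy, WithTop.coe_le_coe, neg_le_neg_iff, Subtype.coe_le_coe]

/-- In a vanishing sum of elements that are not all zero, the least valuation is attained at
least twice. -/
theorem exists_min_valuation_twice {ι : Type*} [Fintype ι] {y : ι → K} (i₀ : ι) (h₀ : y i₀ ≠ 0)
    (hsum : ∑ i, y i = 0) :
    ∃ i j : ι, i ≠ j ∧ ∀ k : ι, v (y i) ≤ v (y k) ∧ v (y j) ≤ v (y k) := by
  classical
  obtain ⟨i, -, hi⟩ := Finset.exists_min_image Finset.univ (fun k => v (y k)) ⟨i₀, by simp⟩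
  have hi' : ∀ k, v (y i) ≤ v (y k) := fun k => hi k (by simp)
  have htop : v (y i) ≠ ⊤ := fun h => v.ne_top_iff.2 h₀ (top_le_iff.1 (h ▸ hi' i₀))
  by_contra! hcon
  have hlt : ∀ j ∈ Finset.univ.erase i, v (y i) < v (y j) := by
    intro j hj
    obtain ⟨k, hk⟩ := hcon i j (Finset.ne_of_mem_erase hj).symm
    exact (hi' k).trans_lt (hk (hi' k))
  have h1 := v.map_lt_sum htop hlt
  rw [← Finset.add_sum_erase _ _ (Finset.mem_univ i)] at hsum
  rw [eq_neg_of_add_eq_zero_left hsum, v.map_neg] at h1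
  exact lt_irrefl _ h1

/-- Over an algebraically closed field, there is a unit of the valuation ring that is not
congruent to `1` modulo the maximal ideal. -/
theorem exists_valuation_eq_zero_and_sub_one [IsAlgClosed K] (v : AddValuation K (WithTop ℝ)) :
    ∃ u : K, v u = 0 ∧ v (u - 1) = 0 := by
  -- A root `u` of this polynomial satisfies `u * (u - 1) = 1`, so `u` and `u - 1` have opposite
  -- valuations. This also works when the residue characteristic is 2.
  have hd : (Polynomial.X ^ 2 - Polynomial.X - 1 : Polynomial K).degree ≠ 0 := by
    have : (Polynomial.X ^ 2 - Polynomial.X - 1 : Polynomial K).degree = 2 := by compute_degree!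
    rw [this]
    decide
  obtain ⟨u, hu⟩ := IsAlgClosed.exists_root _ hd
  have hmul : u * (u - 1) = 1 := by
    simp only [Polynomial.IsRoot, Polynomial.eval_sub, Polynomial.eval_pow, Polynomial.eval_X,
      Polynomial.eval_one] at hu
    linear_combination hu
  have hv : v u + v (u - 1) = 0 := by rw [← v.map_mul, hmul, v.map_one]
  rcases lt_trichotomy (v u) 0 with h | h | h
  · have h1 : v (u - 1) = v u := v.map_sub_eq_of_lt_left (by rwa [v.map_one])
    rw [h1] at hv
    exact absurd (valuation_eq_zero_of_pow two_ne_zero (by rw [v.map_pow, two_nsmul, hv])) h.ne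
  · exact ⟨u, h, by rwa [h, zero_add] at hv⟩
  · have h1 : v (u - 1) = 0 := by
      rw [v.map_sub_eq_of_lt_right (by rwa [v.map_one]), v.map_one]
    rw [h1, add_zero] at hv
    exact absurd hv h.ne'

/-- Prescribed valuations whose minimum is attained twice are the valuations of a family
with vanishing sum. -/
theorem exists_sum_eq_zero_of_maxAttainedTwice [IsAlgClosed K] {ι : Type*} [Fintype ι]
    {φ : ι → valueGroup v} (h : MaxAttainedTwice φ) :
    ∃ y : ι → K, (∀ i, v (y i) = ((-(φ i : ℝ) : ℝ) : WithTop ℝ)) ∧ ∑ i, y i = 0 := by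
  classical
  obtain ⟨i, j, hij, hmax⟩ := h
  choose t ht using fun k => exists_valuation_eq_neg (φ k)
  obtain ⟨u, hu, hu1⟩ := exists_valuation_eq_zero_and_sub_one v
  have hφ : φ i = φ j := le_antisymm (hmax i).2 (hmax j).1
  set S := ∑ k ∈ (Finset.univ.erase i).erase j, t k with hS
  have hSle : v (t j) ≤ v S := v.map_le_sum fun k _ => by
    rw [ht, ht, WithTop.coe_le_coe, neg_le_neg_iff]
    exact (hmax k).2
  -- If adding `S` to `t j` raises the valuation, multiplying `t j` by `u` destroys the
  -- cancellation. Then `-(c + S)` can serve as the entry at `i`.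
  obtain ⟨c, hc, hcS⟩ : ∃ c : K, v c = v (t j) ∧ v (c + S) = v (t j) := by
    by_cases hlt : v (t j) < v (t j + S)
    · refine ⟨u * t j, by rw [v.map_mul, hu, zero_add], ?_⟩
      have h1 : v ((u - 1) * t j) = v (t j) := by rw [v.map_mul, hu1, zero_add]
      rw [show u * t j + S = (u - 1) * t j + (t j + S) by ring,
        v.map_add_eq_of_lt_left (by rwa [h1]), h1]
    · exact ⟨t j, rfl, le_antisymm (not_lt.1 hlt) (v.map_le_add le_rfl hSle)⟩
  refine ⟨Function.update (Function.update t j c) i (-(c + S)), fun k => ?_, ?_⟩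
  · by_cases hki : k = i
    · subst hki
      rw [Function.update_self, v.map_neg, hcS, ht, hφ]
    · rw [Function.update_of_ne hki]
      by_cases hkj : k = j
      · subst hkj
        rw [Function.update_self, hc, ht]
      · rw [Function.update_of_ne hkj, ht]
  · rw [← Finset.add_sum_erase _ _ (Finset.mem_univ i),
      ← Finset.add_sum_erase _ _ (Finset.mem_erase.2 ⟨hij.symm, Finset.mem_univ j⟩),
      Finset.sum_congr rfl (g := t), ← hS]
    · simp [hij.symm]
    · intro k hk
      simp only [Finset.mem_erase] at hk
      rw [Function.update_of_ne hk.2.1, Function.update_of_ne hk.1]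

/-- A tropical root of a univariate tropical polynomial lifts, together with the coefficients,
to a root over the valued field. -/
theorem exists_lift_of_isTropicalRoot [IsAlgClosed K] {I : Finset ℕ} {a : I → valueGroup v}
    {q : valueGroup v} (h : IsTropicalRoot a q) {x : K}
    (hx : v x = ((-(q : ℝ) : ℝ) : WithTop ℝ)) :
    ∃ c : I → K, (∀ i, v (c i) = ((-(a i : ℝ) : ℝ) : WithTop ℝ)) ∧
      ∑ i : I, c i * x ^ (i : ℕ) = 0 := by
  obtain ⟨y, hy, hsum⟩ := exists_sum_eq_zero_of_maxAttainedTwice h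
  have hxi : v x⁻¹ = ((-(-(q : ℝ)) : ℝ) : WithTop ℝ) := by
    rw [v.map_inv, hx]
    rfl
  refine ⟨fun i => y i * x⁻¹ ^ (i : ℕ), fun i => ?_, ?_⟩
  · rw [valuation_mul_pow (hy i) hxi]
    simp
  · rw [← hsum]
    refine Finset.sum_congr rfl fun i _ => ?_
    rw [mul_assoc, ← mul_pow, inv_mul_cancel₀ (ne_zero_of_valuation_eq_coe hx), one_pow, mul_one]

/-- The valuation of a nonzero root of a polynomial with nonzero coefficients gives a tropical
root of its tropicalization. -/
theorem isTropicalRoot_of_root {I : Finset ℕ} (hI : I.Nonempty) {a : I → valueGroup v}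
    {q : valueGroup v} {c : I → K} {x : K}
    (hc : ∀ i, v (c i) = ((-(a i : ℝ) : ℝ) : WithTop ℝ))
    (hx : v x = ((-(q : ℝ) : ℝ) : WithTop ℝ)) (h : ∑ i : I, c i * x ^ (i : ℕ) = 0) :
    IsTropicalRoot a q := by
  obtain ⟨i, hi⟩ := hI
  refine (maxAttainedTwice_iff fun i => ?_).2 (exists_min_valuation_twice ⟨i, hi⟩ ?_ h)
  · rw [valuation_mul_pow (hc i) hx]
    simp
  · exact mul_ne_zero (ne_zero_of_valuation_eq_coe (hc _))
      (pow_ne_zero _ (ne_zero_of_valuation_eq_coe hx))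

end Valued

/-! ### Roots of valuation zero -/

section Univariate

open Polynomial

variable {K : Type*} [Field K] (v : AddValuation K (WithTop ℝ))

/-- The least valuation of a coefficient of `f` is attained exactly once. -/
def HasUniqueMinCoeff (f : K[X]) : Prop :=
  ∃ k, ∀ j, j ≠ k → v (f.coeff k) < v (f.coeff j)

variable {v}

/-- As in Gauss's lemma, the product of the two minimal coefficients has strictly smaller valuation
than any other product of coefficients, so it cannot be cancelled. -/
theorem HasUniqueMinCoeff.mul {f g : K[X]} (hf : HasUniqueMinCoeff v f)
    (hg : HasUniqueMinCoeff v g) : HasUniqueMinCoeff v (f * g) := by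
  classical
  obtain ⟨k, hk⟩ := hf
  obtain ⟨l, hl⟩ := hg
  -- Any index other than `k` shows that the minimum is finite.
  have hkt : v (f.coeff k) ≠ ⊤ := (hk (k + 1) (by simp)).ne_top
  have hlt : v (g.coeff l) ≠ ⊤ := (hl (l + 1) (by simp)).ne_top
  have hle : ∀ i, v (f.coeff k) ≤ v (f.coeff i) := fun i => by
    by_cases h : i = k
    · rw [h]
    · exact (hk i h).le
  have hterm : ∀ x : ℕ × ℕ, x ≠ (k, l) →
      v (f.coeff k * g.coeff l) < v (f.coeff x.1 * g.coeff x.2) := by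
    rintro ⟨i, j⟩ hne
    rw [v.map_mul, v.map_mul]
    by_cases hj : j = l
    · subst hj
      refine WithTop.add_lt_add_right hlt (hk i ?_)
      rintro rfl
      exact hne rfl
    · exact WithTop.add_lt_add_of_le_of_lt hkt (hle i) (hl j hj)
  have htop : v (f.coeff k * g.coeff l) ≠ ⊤ := by
    rw [v.map_mul]
    exact WithTop.add_ne_top.2 ⟨hkt, hlt⟩
  have hmain : v ((f * g).coeff (k + l)) = v (f.coeff k * g.coeff l) := by
    rw [coeff_mul, ← Finset.add_sum_erase _ _ (Finset.HasAntidiagonal.mem_antidiagonal.2 rfl :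
      (k, l) ∈ Finset.HasAntidiagonal.antidiagonal (k + l))]
    exact v.map_add_eq_of_lt_left
      (v.map_lt_sum htop fun x hx => hterm x (Finset.ne_of_mem_erase hx))
  refine ⟨k + l, fun n hn => ?_⟩
  rw [hmain, coeff_mul]
  refine v.map_lt_sum htop fun x hx => hterm x ?_
  rintro rfl
  exact hn (Finset.HasAntidiagonal.mem_antidiagonal.1 hx).symm

theorem hasUniqueMinCoeff_C {c : K} (hc : c ≠ 0) : HasUniqueMinCoeff v (C c) := by
  refine ⟨0, fun j hj => ?_⟩
  rw [coeff_C_zero, coeff_C_of_ne_zero hj, v.map_zero]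
  exact lt_top_iff_ne_top.2 (v.ne_top_iff.2 hc)

theorem hasUniqueMinCoeff_X_sub_C {r : K} (hr : v r ≠ 0) : HasUniqueMinCoeff v (X - C r) := by
  have h0 : v ((X - C r).coeff 0) = v r := by simp
  have h1 : v ((X - C r).coeff 1) = 0 := by simp [coeff_X]
  have h2 : ∀ j, 2 ≤ j → v ((X - C r).coeff j) = ⊤ := fun j hj => by
    rw [coeff_sub, coeff_X_of_ne_one (by omega), coeff_C_of_ne_zero (by omega), sub_zero, v.map_zero]
  rcases lt_or_gt_of_ne hr with h | h
  · refine ⟨0, fun j hj => ?_⟩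
    rw [h0]
    rcases (by omega : j = 1 ∨ 2 ≤ j) with rfl | hj
    · rwa [h1]
    · rw [h2 j hj]
      exact h.trans (WithTop.coe_lt_top 0)
  · refine ⟨1, fun j hj => ?_⟩
    rw [h1]
    rcases (by omega : j = 0 ∨ 2 ≤ j) with rfl | hj
    · rwa [h0]
    · rw [h2 j hj]
      exact WithTop.coe_lt_top 0

/-- Each factor `X - r` has coefficients of distinct valuations `0` and `v r`, and the property is
multiplicative. -/
theorem hasUniqueMinCoeff_of_roots [IsAlgClosed K] {f : K[X]} (hf : f ≠ 0)
    (h : ∀ r ∈ f.roots, v r ≠ 0) : HasUniqueMinCoeff v f := by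
  rw [(IsAlgClosed.splits f).eq_prod_roots]
  refine (hasUniqueMinCoeff_C (leadingCoeff_ne_zero.2 hf)).mul ?_
  generalize f.roots = s at h
  induction s using Multiset.induction with
  | empty => simpa using hasUniqueMinCoeff_C (v := v) (one_ne_zero (α := K))
  | cons r s ih =>
    rw [Multiset.map_cons, Multiset.prod_cons]
    exact (hasUniqueMinCoeff_X_sub_C (h r (by simp))).mul
      (ih fun t ht => h t (Multiset.mem_cons_of_mem ht))

/-- If the least valuation of a coefficient is attained twice, then there is a root of
valuation zero. -/
theorem exists_root_valuation_eq_zero [IsAlgClosed K] {f : K[X]} (hf : f ≠ 0) {i j : ℕ}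
    (hij : i ≠ j)
    (h : ∀ k, v (f.coeff i) ≤ v (f.coeff k) ∧ v (f.coeff j) ≤ v (f.coeff k)) :
    ∃ z : K, v z = 0 ∧ f.eval z = 0 := by
  by_contra! hcon
  obtain ⟨k, hk⟩ := hasUniqueMinCoeff_of_roots (v := v) hf
    fun r hr hv => hcon r hv (mem_roots'.1 hr).2
  by_cases hik : i = k
  · exact absurd (h k).2 (not_le.2 (hk j fun hjk => hij (hik.trans hjk.symm)))
  · exact absurd (h k).1 (not_le.2 (hk i hik))

end Univariate

/-! ### Kapranov's theorem for a hypersurface -/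

section Multivariate

/-- A finite set of exponents is separated by some linear form with coefficients in `ℕ`. -/
theorem exists_injOn_sum_mul {σ : Type*} [Fintype σ] (S : Finset (σ →₀ ℕ)) :
    ∃ N : σ → ℕ, Set.InjOn (fun m : σ →₀ ℕ => ∑ s, m s * N s) S := by
  let e := Fintype.equivFin σ
  -- `B` exceeds every exponent, so each exponent vector is the digit sequence of its weight in base
  -- `B`.
  let B := (S.sup fun m => Finset.univ.sup m) + 1
  have hB : ∀ m ∈ S, ∀ s, m s < B := fun m hm s =>
    Nat.lt_succ_of_le ((Finset.le_sup (f := m) (Finset.mem_univ s)).trans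
      (Finset.le_sup (f := fun m : σ →₀ ℕ => Finset.univ.sup m) hm))
  refine ⟨fun s => B ^ (e s : ℕ), fun m hm m' hm' h => ?_⟩
  have key : ∀ (n : σ →₀ ℕ) (hn : n ∈ S), ∑ s, n s * B ^ (e s : ℕ) =
      (finFunctionFinEquiv fun i => (⟨n (e.symm i), hB n hn _⟩ : Fin B) : ℕ) := fun n hn => by
    rw [finFunctionFinEquiv_apply]
    exact Fintype.sum_equiv e _ _ fun s => by simp
  have h' : ∑ s, m s * B ^ (e s : ℕ) = ∑ s, m' s * B ^ (e s : ℕ) := h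
  rw [key m hm, key m' hm', Fin.val_inj, EmbeddingLike.apply_eq_iff_eq] at h'
  ext s
  simpa using congrArg Fin.val (congrFun h' (e s))

variable {K : Type*} [Field K] {v : AddValuation K (WithTop ℝ)} {σ : Type*}

theorem valuation_monomial_eq (F : MvPolynomial σ K) {w : σ → valueGroup v} {t : σ → K}
    (ht : ∀ s, v (t s) = ((-(w s : ℝ) : ℝ) : WithTop ℝ)) (m : F.support) :
    v (F.coeff m * (m : σ →₀ ℕ).prod fun s e => t s ^ e) =
      ((-(((tropicalization v F).coeff m + (m : σ →₀ ℕ).sum fun s e => e • w s :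
        valueGroup v) : ℝ) : ℝ) : WithTop ℝ) := by
  have hprod : ∀ S : Finset σ, v (∏ s ∈ S, t s ^ (m : σ →₀ ℕ) s) =
      ((-((∑ s ∈ S, (m : σ →₀ ℕ) s • w s : valueGroup v) : ℝ) : ℝ) : WithTop ℝ) := by
    classical
    intro S
    induction S using Finset.induction with
    | empty => simp
    | insert s S hs ih =>
      rw [Finset.prod_insert hs, Finset.sum_insert hs, mul_comm, valuation_mul_pow ih (ht s)]
      simp [add_comm]
  rw [v.map_mul, Finsupp.prod, hprod,
    valuation_eq_neg_tropVal _ (MvPolynomial.mem_support_iff.1 m.2), ← WithTop.coe_add, ← neg_add]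
  rfl

/-- The image under `T` of a zero of a nonzero polynomial is a zero of its tropicalization. -/
theorem mem_zeros_tropicalization_of_eval_eq_zero {F : MvPolynomial σ K} (hF : F ≠ 0)
    {w : σ → valueGroup v} {t : σ → K}
    (ht : ∀ s, v (t s) = ((-(w s : ℝ) : ℝ) : WithTop ℝ)) (h : MvPolynomial.eval t F = 0) :
    w ∈ (tropicalization v F).zeros := by
  obtain ⟨m, hm⟩ := MvPolynomial.support_nonempty.2 hF
  refine (maxAttainedTwice_iff fun m => valuation_monomial_eq F ht m).2
    (exists_min_valuation_twice (ι := F.support) ⟨m, hm⟩ ?_ ?_)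
  · refine mul_ne_zero (MvPolynomial.mem_support_iff.1 hm) ?_
    exact Finset.prod_ne_zero_iff.2 fun s _ => pow_ne_zero _ (ne_zero_of_valuation_eq_coe (ht s))
  · rw [← h, MvPolynomial.eval_eq]
    exact Finset.sum_coe_sort F.support fun m => F.coeff m * m.prod fun s e => t s ^ e

/-- Every tropical zero of the tropicalization of a polynomial over an algebraically closed
valued field lifts to a zero. -/
theorem exists_lift_of_mem_zeros_tropicalization [IsAlgClosed K] [Fintype σ]
    {F : MvPolynomial σ K} {w : σ → valueGroup v} (hw : w ∈ (tropicalization v F).zeros) :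
    ∃ x : σ → K, (∀ s, v (x s) = ((-(w s : ℝ) : ℝ) : WithTop ℝ)) ∧
      MvPolynomial.eval x F = 0 := by
  classical
  choose t ht using fun s => exists_valuation_eq_neg (w s)
  obtain ⟨N, hN⟩ := exists_injOn_sum_mul F.support
  obtain ⟨m₁, m₂, hne, hmin⟩ := (maxAttainedTwice_iff fun m => valuation_monomial_eq F ht m).1 hw
  let c : (σ →₀ ℕ) → K := fun m => F.coeff m * m.prod fun s e => t s ^ e
  let d : (σ →₀ ℕ) → ℕ := fun m => ∑ s, m s * N s
  -- This is `F` along the curve `z ↦ (t s * z ^ N s)`. Separated weights keep its monomials apart,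
  -- and a root of valuation zero leaves the coordinate valuations unchanged.
  let h : Polynomial K := ∑ m ∈ F.support, Polynomial.monomial (d m) (c m)
  have hcoeff : ∀ m ∈ F.support, h.coeff (d m) = c m := fun m hm => by
    rw [Polynomial.finsetSum_coeff, Finset.sum_eq_single m]
    · exact Polynomial.coeff_monomial_same _ _
    · intro m' hm' hne'
      exact Polynomial.coeff_monomial_of_ne _ fun he => hne' (hN hm hm' he).symm
    · exact fun hm' => absurd hm hm'
  have hle : ∀ m : F.support, (∀ k : F.support, v (c m) ≤ v (c k)) →
      ∀ k, v (h.coeff (d m)) ≤ v (h.coeff k) := fun m hm k => by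
    rw [hcoeff m m.2, Polynomial.finsetSum_coeff]
    refine v.map_le_sum fun m' hm' => ?_
    rw [Polynomial.coeff_monomial]
    split_ifs
    · exact hm ⟨m', hm'⟩
    · simp
  have hc : c m₁ ≠ 0 := ne_zero_of_valuation_eq_coe (valuation_monomial_eq F ht m₁)
  have hh : h ≠ 0 := fun h0 => hc (by rw [← hcoeff m₁ m₁.2, h0, Polynomial.coeff_zero])
  obtain ⟨z, hz, hroot⟩ := exists_root_valuation_eq_zero (v := v) hh
    (i := d m₁) (j := d m₂) (fun he => hne (Subtype.ext (hN m₁.2 m₂.2 he)))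
    fun k => ⟨hle m₁ (fun k => (hmin k).1) k, hle m₂ (fun k => (hmin k).2) k⟩
  refine ⟨fun s => t s * z ^ N s, fun s => ?_, ?_⟩
  · rw [v.map_mul, v.map_pow, hz, smul_zero, add_zero, ht]
  · rw [← hroot, MvPolynomial.eval_eq', Polynomial.eval_finsetSum]
    refine Finset.sum_congr rfl fun m _ => ?_
    rw [Polynomial.eval_monomial, mul_assoc, Finsupp.prod_fintype _ _ fun s => pow_zero _,
      ← Finset.prod_pow_eq_pow_sum, ← Finset.prod_mul_distrib]
    congr 1
    refine Finset.prod_congr rfl fun s _ => ?_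
    rw [mul_pow, ← pow_mul, mul_comm (N s)]

end Multivariate

/-! ### Resultants and the main equivalence -/

theorem IsResultant.map_ne_zero {p : ℕ} {K : Type*} [Field K] [CharP K p]
    {v : AddValuation K (WithTop ℝ)} (hv : ∃ x : K, x ≠ 0 ∧ v x ≠ 0) {I J : Finset ℕ}
    (hI : 2 ≤ I.card) (hJ : 2 ≤ J.card) (hI0 : 0 ∈ I) (hJ0 : 0 ∈ J)
    {R : MvPolynomial (I ⊕ J) (ZMod p)} (hR : IsResultant p K I J R) :
    MvPolynomial.map (ZMod.castHom dvd_rfl K) R ≠ 0 := by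
  intro h
  obtain ⟨c, hc, hvc⟩ := hv
  -- If `R` were zero in `K`, then `x ^ max I = 1` and `x ^ max J = c` would have a common solution,
  -- forcing `v c = 0`.
  obtain ⟨a, ha, hfa⟩ := exists_binomial_of_support hI hI0 (one_ne_zero (α := K))
  obtain ⟨b, hb, hfb⟩ := exists_binomial_of_support hJ hJ0 hc
  obtain ⟨x, hx1, hx2⟩ := (hR a b ha hb).1 (by rw [← MvPolynomial.eval_map, h, map_zero])
  rw [hfa, sub_eq_zero] at hx1
  rw [hfb, sub_eq_zero] at hx2
  have hvx : v x = 0 := valuation_eq_zero_of_pow (sup_id_ne_zero hI) (by rw [hx1, v.map_one])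
  apply hvc
  rw [← hx2, v.map_pow, hvx, smul_zero]

theorem mainTheorem7 {K : Type*} [Field K] [IsAlgClosed K] (p : ℕ) [CharP K p]
    (v : AddValuation K (WithTop ℝ)) (hv : ∃ x : K, x ≠ 0 ∧ v x ≠ 0)
    (I J : Finset ℕ) (hI : 2 ≤ I.card) (hJ : 2 ≤ J.card) (hI0 : 0 ∈ I) (hJ0 : 0 ∈ J) :
    IsResultant p K I J (sylvesterResultant p I J) ∧
    ∀ R : MvPolynomial (I ⊕ J) (ZMod p), IsResultant p K I J R →
      ∀ (a : I → valueGroup v) (b : J → valueGroup v),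
        (∃ q : valueGroup v, IsTropicalRoot a q ∧ IsTropicalRoot b q) ↔
          Sum.elim a b ∈ (tropicalResultant v R).zeros := by
  refine ⟨isResultant_sylvesterResultant p K ⟨0, hI0⟩ ⟨0, hJ0⟩, fun R hR a b => ⟨?_, fun h => ?_⟩⟩
  · rintro ⟨q, hqa, hqb⟩
    obtain ⟨x, hx⟩ := exists_valuation_eq_neg q
    obtain ⟨c, hc, hcx⟩ := exists_lift_of_isTropicalRoot hqa hx
    obtain ⟨d, hd, hdx⟩ := exists_lift_of_isTropicalRoot hqb hx
    refine mem_zeros_tropicalization_of_eval_eq_zero (hR.map_ne_zero hv hI hJ hI0 hJ0)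
      (t := Sum.elim c d) (by rintro (i | j) <;> simp [hc, hd]) ?_
    rw [MvPolynomial.eval_map]
    exact (hR c d (fun i _ => ne_zero_of_valuation_eq_coe (hc i))
      fun j _ => ne_zero_of_valuation_eq_coe (hd j)).2 ⟨x, hcx, hdx⟩
  · obtain ⟨y, hy, hroot⟩ := exists_lift_of_mem_zeros_tropicalization h
    have hc : ∀ i, v (y (Sum.inl i)) = ((-(a i : ℝ) : ℝ) : WithTop ℝ) := fun i => hy (Sum.inl i)
    have hd : ∀ j, v (y (Sum.inr j)) = ((-(b j : ℝ) : ℝ) : WithTop ℝ) := fun j => hy (Sum.inr j)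
    rw [MvPolynomial.eval_map, ← Sum.elim_comp_inl_inr y] at hroot
    obtain ⟨x, hcx, hdx⟩ := (hR (y ∘ Sum.inl) (y ∘ Sum.inr)
      (fun i _ => ne_zero_of_valuation_eq_coe (hc i))
      fun j _ => ne_zero_of_valuation_eq_coe (hd j)).1 hroot
    have hx0 : x ≠ 0 := by
      rintro rfl
      rw [Finset.sum_eq_single ⟨0, hI0⟩] at hcx
      · exact ne_zero_of_valuation_eq_coe (hc ⟨0, hI0⟩) (by simpa using hcx)
      · intro i _ hi
        rw [zero_pow fun h0 => hi (Subtype.ext h0), mul_zero]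
      · simp
    exact ⟨tropVal v x hx0,
      isTropicalRoot_of_root ⟨0, hI0⟩ hc (valuation_eq_neg_tropVal x hx0) hcx,
      isTropicalRoot_of_root ⟨0, hJ0⟩ hd (valuation_eq_neg_tropVal x hx0) hdx⟩
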